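/- Let $\Gamma$ be a countable group and let $\mathcal F(\Gamma)$ be the set of its nonempty finite subsets. For $K\in\mathcal F(\Gamma)$ and $\delta>0$ let $\mathcal B(K,\delta)$ be the set of all $F\in\mathcal F(\Gamma)$ with $|\{t\in F: Kt\subseteq F\}|\ge(1-\delta)|F|$. Assume that $\Gamma$ is amenable, i.e. that $\mathcal B(K,\delta)\neq\emptyset$ for all $K\in\mathcal F(\Gamma)$ and $\delta>0$. Write $\lim_F\varphi(F)=c$ if for every $\varepsilon>0$ there are $K\in\mathcal F(\Gamma)$ and $\delta>0$ such that $|\varphi(F)-c|<\varepsilon$ for all $F\in\mathcal B(K,\delta)$. Let $\Gamma$ act continuously on compact metrizable spaces $X$ and $Y$, and let $\pi\colon X\to Y$ be a factor map, i.e. a continuous $\Gamma$-equivariant surjection. For families $\mathcal A,\mathcal B$ of subsets of $X$ put $\mathcal A\vee\mathcal B=\{A\cap B: A\in\mathcal A,\ B\in\mathcal B\}$, and say that $\mathcal A$ refines $\mathcal B$ if every element of $\mathcal A$ is contained in an element of $\mathcal B$. For a finite open cover $\mathcal W$ of $X$ put $\mathrm{ord}(\mathcal W)=\max_{x\in X}|\{W\in\mathcal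 W: x\in W\}|-1$ (read as $0$ if $X=\emptyset$). For a finite open cover $\mathcal U$ of $X$ let $\mathcal D(\mathcal U|Y)$ be the minimum of $\mathrm{ord}(\mathcal W)$ over all finite open covers $\mathcal W$ of $X$ such that $\{\pi^{-1}(y)\}_{y\in Y}\vee\mathcal W$ refines $\mathcal U$, and for $F\in\mathcal F(\Gamma)$ let $\mathcal U^F=\bigvee_{s\in F}s^{-1}\mathcal U$. Define the conditional mean dimension $$\mathrm{mdim}(X|Y)=\sup_{\mathcal U}\lim_F\frac{\mathcal D(\mathcal U^F|Y)}{|F|}\in[0,\infty],$$ where $\mathcal U$ runs over all finite open covers of $X$, and let the mean dimension $\mathrm{mdim}(X)$ be the same quantity with $Y$ replaced by a one-point space; $\mathrm{mdim}(Y)$ is defined in the same way from the action on $Y$. Then the limits in the definitions of $\mathrm{mdim}(X)$, $\mathrm{mdim}(Y)$ and $\mathrm{mdim}(X|Y)$ exist and are finite for every finite open cover, and $$\mathrm{mdim}(X)\le\mathrm{mdim}(Y)+\mathrm{mdim}(X|Y).$$ -/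

import Mathlib

open Filter Topology
open scoped ENNReal

namespace CondMdim

section Amenable

/-- `ℬ(K, δ)`: the nonempty finite `F ⊆ Γ` with `|{t ∈ F : K t ⊆ F}| ≥ (1 - δ) |F|`. -/
def invariantSets {Γ : Type*} [Group Γ] (K : Finset Γ) (δ : ℝ) : Set (Finset Γ) :=
  {F | F.Nonempty ∧ (1 - δ) * (F.card : ℝ) ≤ ({t | t ∈ F ∧ ∀ k ∈ K, k * t ∈ F}.ncard : ℝ)}

/-- Amenability: every `ℬ(K, δ)` is nonempty. -/
def IsAmenable (Γ : Type*) [Group Γ] : Prop :=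
  ∀ K : Finset Γ, K.Nonempty → ∀ δ : ℝ, 0 < δ → (invariantSets K δ).Nonempty

/-- The filter "as `F` becomes more and more invariant", generated by the sets `ℬ(K, δ)`. -/
def invariantFilter (Γ : Type*) [Group Γ] : Filter (Finset Γ) :=
  ⨅ (K : Finset Γ) (_ : K.Nonempty) (δ : ℝ) (_ : 0 < δ), 𝓟 (invariantSets K δ)

end Amenable

section Covers

/-- Finite open covers of `X`, as families of subsets. -/
structure IsFinOpenCover {X : Type*} [TopologicalSpace X] (𝒰 : Set (Set X)) : Prop where
  finite : 𝒰.Finite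
  isOpen : ∀ U ∈ 𝒰, IsOpen U
  sUnion_eq : ⋃₀ 𝒰 = Set.univ

/-- `𝒜` refines `ℬ`: every element of `𝒜` is contained in some element of `ℬ`. -/
def Refines {X : Type*} (𝒜 ℬ : Set (Set X)) : Prop :=
  ∀ A ∈ 𝒜, ∃ B ∈ ℬ, A ⊆ B

/-- The joining `𝒜 ∨ ℬ = {A ∩ B : A ∈ 𝒜, B ∈ ℬ}`. -/
def join {X : Type*} (𝒜 ℬ : Set (Set X)) : Set (Set X) :=
  Set.image2 (fun A B => A ∩ B) 𝒜 ℬ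

/-- The family of fibers `{π⁻¹(y)}` for `y ∈ Y`. -/
def fibers {X Y : Type*} (π : X → Y) : Set (Set X) :=
  Set.range fun y => π ⁻¹' {y}

/-- `ord(𝒲) = max_x (number of elements of 𝒲 containing x) - 1`, for a finite family `𝒲`. The
maximum is at least `1` for a cover of a nonempty space; on the empty space the value is `0`. -/
noncomputable def ord {X : Type*} (𝒲 : Set (Set X)) : ℕ :=
  (⨆ x : X, {W | W ∈ 𝒲 ∧ x ∈ W}.ncard) - 1

/-- `𝒟(𝒰 | Y)`: the least `ord(𝒲)` over the finite open covers `𝒲` of `X` such that the joining of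
`𝒲` with the fibers of `π` refines `𝒰`. -/
noncomputable def condD {X Y : Type*} [TopologicalSpace X] (π : X → Y) (𝒰 : Set (Set X)) : ℕ :=
  sInf {n | ∃ 𝒲 : Set (Set X), IsFinOpenCover 𝒲 ∧ Refines (join (fibers π) 𝒲) 𝒰 ∧ ord 𝒲 = n}

/-- `𝒰^F`, the joining of the covers `s⁻¹𝒰` for `s ∈ F`: its elements are the intersections
of sets `s⁻¹ U_s` for `s ∈ F`, with all `U_s ∈ 𝒰`. -/
def coverPow {Γ X : Type*} [Group Γ] [MulAction Γ X] (𝒰 : Set (Set X)) (F : Finset Γ) :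
    Set (Set X) :=
  {A | ∃ U : Γ → Set X, (∀ s ∈ F, U s ∈ 𝒰) ∧ A = ⋂ s ∈ F, (fun x : X => s • x) ⁻¹' U s}

theorem IsFinOpenCover.coverPow {Γ X : Type*} [Group Γ] [TopologicalSpace X] [MulAction Γ X]
    [ContinuousConstSMul Γ X] {𝒰 : Set (Set X)} (h : IsFinOpenCover 𝒰) (F : Finset Γ) :
    IsFinOpenCover (CondMdim.coverPow 𝒰 F) := by
  refine ⟨?_, ?_, ?_⟩
  · have : Finite 𝒰 := h.finite
    refine (Set.finite_range fun V : F → 𝒰 =>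
      ⋂ s : F, (fun x : X => (s : Γ) • x) ⁻¹' (V s : Set X)).subset ?_
    rintro A ⟨U, hU, rfl⟩
    exact ⟨fun s => ⟨U s, hU s s.2⟩, by ext x; simp⟩
  · rintro A ⟨U, hU, rfl⟩
    exact isOpen_biInter_finset fun s hs =>
      (h.isOpen _ (hU s hs)).preimage (continuous_const_smul s)
  · refine Set.eq_univ_of_forall fun x => ?_
    have key : ∀ s : Γ, ∃ U ∈ 𝒰, s • x ∈ U := fun s =>
      Set.mem_sUnion.1 (h.sUnion_eq ▸ Set.mem_univ (s • x))
    choose U hU hx using key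
    exact ⟨_, ⟨U, fun s _ => hU s, rfl⟩, by simp [hx]⟩

/-- For a finite open cover `𝒰` the minimum defining `𝒟(𝒰 | Y)` is attained. -/
theorem exists_ord_eq_condD {X Y : Type*} [TopologicalSpace X] (π : X → Y) {𝒰 : Set (Set X)}
    (h : IsFinOpenCover 𝒰) :
    ∃ 𝒲 : Set (Set X), IsFinOpenCover 𝒲 ∧ Refines (join (fibers π) 𝒲) 𝒰 ∧
      ord 𝒲 = condD π 𝒰 := by
  refine Nat.sInf_mem
    (s := {n | ∃ 𝒲 : Set (Set X), IsFinOpenCover 𝒲 ∧ Refines (join (fibers π) 𝒲) 𝒰 ∧ ord 𝒲 = n})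
    ⟨ord 𝒰, 𝒰, h, ?_, rfl⟩
  rintro _ ⟨A, _, B, hB, rfl⟩
  exact ⟨B, hB, Set.inter_subset_right⟩

end Covers

section MeanDimension

/-- The quotient `𝒟(𝒰^F | Y) / |F|`. -/
noncomputable def condDAverage {Γ X Y : Type*} [Group Γ] [TopologicalSpace X] [MulAction Γ X]
    (π : X → Y) (𝒰 : Set (Set X)) (F : Finset Γ) : ℝ≥0∞ :=
  (condD π (coverPow 𝒰 F) : ℝ≥0∞) / (F.card : ℝ≥0∞)

/-- The upper limit of `𝒟(𝒰^F | Y) / |F|` as `F` becomes more and more invariant; it is the limit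
whenever `LimitsExist Γ π` holds. -/
noncomputable def coverMdim (Γ : Type*) {X Y : Type*} [Group Γ] [TopologicalSpace X]
    [MulAction Γ X] (π : X → Y) (𝒰 : Set (Set X)) : ℝ≥0∞ :=
  limsup (condDAverage (Γ := Γ) π 𝒰) (invariantFilter Γ)

/-- For every finite open cover `𝒰` of `X`, `𝒟(𝒰^F | Y) / |F|` converges (to a finite limit) as
`F` becomes more and more invariant, and `coverMdim Γ π 𝒰` is the limit. -/
def LimitsExist (Γ : Type*) {X Y : Type*} [Group Γ] [TopologicalSpace X] [MulAction Γ X]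
    (π : X → Y) : Prop :=
  ∀ 𝒰 : Set (Set X), IsFinOpenCover 𝒰 →
    coverMdim Γ π 𝒰 ≠ ∞ ∧
      Tendsto (condDAverage (Γ := Γ) π 𝒰) (invariantFilter Γ) (𝓝 (coverMdim Γ π 𝒰))

/-- The conditional mean dimension `mdim(X | Y)`. -/
noncomputable def condMdim (Γ : Type*) {X Y : Type*} [Group Γ] [TopologicalSpace X]
    [MulAction Γ X] (π : X → Y) : ℝ≥0∞ :=
  ⨆ (𝒰 : Set (Set X)) (_ : IsFinOpenCover 𝒰), coverMdim Γ π 𝒰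

/-- The map from `X` to the one-point space. -/
def toPoint (X : Type*) : X → Unit := fun _ => ()

/-- The mean dimension `mdim(X)`: the conditional mean dimension relative to a point. -/
noncomputable def mdim (Γ X : Type*) [Group Γ] [TopologicalSpace X] [MulAction Γ X] : ℝ≥0∞ :=
  condMdim Γ (toPoint X)

end MeanDimension

end CondMdim

/-!
Two finite open covers of orders `m` and `n` of a normal space have a common open refinement of
order at most `m + n`. Hence relative orders obey a chain rule: `𝒟(𝒰 | Z) ≤ 𝒟(𝒱 | Z) + 𝒟(𝒰 | 𝒱)` for
a tower `X → Y → Z`, a cover `𝒱` of `Y` and the order `𝒟(𝒰 | 𝒱)` of `𝒰` relative to the family of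
preimages of the elements of `𝒱`. For the same reason `𝒟(𝒰^F | Z)` and `𝒟(𝒰^F | 𝒱^F)` are
subadditive in `F`; they are right invariant too, so the limits exist by the Ornstein–Weiss lemma.

By compactness every `𝒰` has a `𝒱` with `𝒟(𝒰 | 𝒱) ≤ 𝒟(𝒰 | Y)`, but this `𝒱` depends on `𝒰`, hence
on `F` if it is applied to `𝒰^F`. To find one `𝒱` for all `F`, choose finitely many tiles `T` that
quasitile all sufficiently invariant sets and for which `𝒟(𝒰^T | Y) / |T|` is close to its limit.
Some `𝒱` satisfies `𝒟(𝒰^T | 𝒱^T) ≤ 𝒟(𝒰^T | Y)` for these finitely many `T`, and quasitiling carries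
the estimate over to `𝒟(𝒰^F | 𝒱^F)` for every sufficiently invariant `F`.
-/

namespace CondMdim

section OrnsteinWeiss

open scoped Pointwise

variable {Γ : Type*} [Group Γ]

section Core

variable [DecidableEq Γ]

/-- The set `{t ∈ F : K t ⊆ F}` that measures the invariance of `F` under `K`. -/
def core (K F : Finset Γ) : Finset Γ := {t ∈ F | ∀ k ∈ K, k * t ∈ F}

theorem core_subset (K F : Finset Γ) : core K F ⊆ F := Finset.filter_subset _ _

theorem mem_sdiff_core {K F : Finset Γ} {t : Γ} :
    t ∈ F \ core K F ↔ t ∈ F ∧ ∃ k ∈ K, k * t ∉ F := by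
  simp +contextual [core]

theorem mem_invariantSets {K F : Finset Γ} {δ : ℝ} :
    F ∈ invariantSets K δ ↔ F.Nonempty ∧ (1 - δ) * F.card ≤ (core K F).card := by
  have : {t | t ∈ F ∧ ∀ k ∈ K, k * t ∈ F} = (core K F : Set Γ) := by simp [core]
  rw [invariantSets, Set.mem_ofPred_eq, this, Set.ncard_coe_finset]

theorem mem_invariantSets_iff_sdiff {K F : Finset Γ} {δ : ℝ} :
    F ∈ invariantSets K δ ↔ F.Nonempty ∧ ((F \ core K F).card : ℝ) ≤ δ * F.card := by
  rw [mem_invariantSets, Finset.cast_card_sdiff (core_subset K F)]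
  exact and_congr_right fun _ => by constructor <;> intro <;> linarith

theorem card_mul_sdiff_le {K T : Finset Γ} {η : ℝ} (hT : T ∈ invariantSets K η) :
    (((K * T) \ T).card : ℝ) ≤ K.card * (η * T.card) := by
  have hsub : (K * T) \ T ⊆ K * (T \ core K T) := by
    intro x hx
    obtain ⟨hx, hxT⟩ := Finset.mem_sdiff.1 hx
    obtain ⟨k, hk, t, ht, rfl⟩ := Finset.mem_mul.1 hx
    exact Finset.mul_mem_mul hk (mem_sdiff_core.2 ⟨ht, k, hk, hxT⟩)
  calc (((K * T) \ T).card : ℝ) ≤ K.card * (T \ core K T).card := by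
        exact_mod_cast (Finset.card_le_card hsub).trans Finset.card_mul_le
    _ ≤ K.card * (η * T.card) := by gcongr; exact (mem_invariantSets_iff_sdiff.1 hT).2

theorem sdiff_core_sdiff_subset (K T C F : Finset Γ) :
    (F \ (T * C)) \ core K (F \ (T * C)) ⊆ (F \ core K F) ∪ ((K⁻¹ * T) \ T) * C := by
  intro t ht
  obtain ⟨htR, k, hk, hkt⟩ := mem_sdiff_core.1 ht
  obtain ⟨htF, htTC⟩ := Finset.mem_sdiff.1 htR
  by_cases hkF : k * t ∈ F
  · have hkTC : k * t ∈ T * C := by simpa [hkF] using hkt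
    obtain ⟨s, hs, c, hc, hsc⟩ := Finset.mem_mul.1 hkTC
    obtain rfl : k⁻¹ * s * c = t := by rw [mul_assoc, hsc, inv_mul_cancel_left]
    refine Finset.mem_union_right _ (Finset.mul_mem_mul (Finset.mem_sdiff.2
      ⟨Finset.mul_mem_mul (Finset.inv_mem_inv hk) hs, fun h => htTC ?_⟩) hc)
    exact Finset.mul_mem_mul h hc
  · exact Finset.mem_union_left _ (mem_sdiff_core.2 ⟨htF, k, hk, hkF⟩)

theorem card_sdiff_core_sdiff_le {K T F : Finset Γ} {δ η : ℝ} (C : Finset Γ)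
    (hF : F ∈ invariantSets K δ) (hT : T ∈ invariantSets K⁻¹ η) :
    (((F \ (T * C)) \ core K (F \ (T * C))).card : ℝ) ≤
      δ * F.card + K.card * (η * T.card) * C.card := by
  have hcard := (Finset.card_le_card (sdiff_core_sdiff_subset K T C F)).trans
    ((Finset.card_union_le _ _).trans (Nat.add_le_add_left Finset.card_mul_le _))
  have hbdry := card_mul_sdiff_le hT
  rw [Finset.card_inv] at hbdry
  calc (((F \ (T * C)) \ core K (F \ (T * C))).card : ℝ)
      ≤ (F \ core K F).card + ((K⁻¹ * T) \ T).card * C.card := by exact_mod_cast hcard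
    _ ≤ δ * F.card + K.card * (η * T.card) * C.card := by
        gcongr; exact (mem_invariantSets_iff_sdiff.1 hF).2

theorem sdiff_mul_mem_invariantSets {K T C F : Finset Γ} {δ ε : ℝ} (hK : K.Nonempty)
    (hδ : 0 < δ) (hε : 0 < ε) (hF : F ∈ invariantSets K (δ * ε / 2))
    (hT : T ∈ invariantSets K⁻¹ (δ * ε * (1 - ε) / (2 * K.card)))
    (hdisj : (1 - ε) * (T.card * C.card) ≤ (T * C).card) (hsub : T * C ⊆ F)
    (hlarge : ε * F.card < (F \ (T * C)).card) : F \ (T * C) ∈ invariantSets K δ := by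
  have : (0 : ℝ) < K.card := by exact_mod_cast hK.card_pos
  refine mem_invariantSets_iff_sdiff.2 ⟨Finset.card_pos.1 ?_, ?_⟩
  · exact_mod_cast lt_of_le_of_lt (by positivity : 0 ≤ ε * F.card) hlarge
  calc (((F \ (T * C)) \ core K (F \ (T * C))).card : ℝ)
      ≤ δ * ε / 2 * F.card
        + K.card * (δ * ε * (1 - ε) / (2 * K.card) * T.card) * C.card :=
        card_sdiff_core_sdiff_le C hF hT
    _ = δ * ε / 2 * F.card + δ * ε / 2 * ((1 - ε) * (T.card * C.card)) := by field_simp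
    _ ≤ δ * ε / 2 * F.card + δ * ε / 2 * F.card := by
        gcongr
        exact hdisj.trans (by exact_mod_cast Finset.card_le_card hsub)
    _ = δ * (ε * F.card) := by ring
    _ ≤ δ * (F \ (T * C)).card := by gcongr

theorem sum_card_mul_singleton_inter_le (T S A : Finset Γ) :
    ∑ c ∈ S, ((T * {c}) ∩ A).card ≤ A.card * T.card := by
  have hcount (a : Γ) : (S.filter fun c => a ∈ T * {c}).card ≤ T.card := by
    refine Finset.card_le_card_of_injOn (fun c => a * c⁻¹) (fun c hc => ?_) (by simp [Set.InjOn])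
    obtain ⟨t, ht, _, hc', rfl⟩ := Finset.mem_mul.1 (Finset.mem_filter.1 hc).2
    simpa [Finset.mem_singleton.1 hc'] using ht
  calc ∑ c ∈ S, ((T * {c}) ∩ A).card = ∑ a ∈ A, (S.filter fun c => a ∈ T * {c}).card := by
        simp_rw [Finset.inter_comm _ A, ← Finset.filter_mem_eq_inter, Finset.card_filter]
        exact Finset.sum_comm
    _ ≤ A.card * T.card := Finset.sum_le_card_nsmul _ _ _ fun a _ => hcount a

/-- If a translate of `T` met the union `T * C` in fewer than `ε |T|` points, then its center could
be added to `C`; counting incidences gives the lower bound. -/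
theorem exists_almost_disjoint_translates {T : Finset Γ} (S : Finset Γ) (hT : T.Nonempty) {ε : ℝ}
    (hε1 : ε ≤ 1) :
    ∃ C ⊆ S, (1 - ε) * (T.card * C.card) ≤ (T * C).card ∧ ε * S.card ≤ (T * C).card := by
  obtain ⟨C, hC, hmax⟩ := Finset.exists_max_image
    (S.powerset.filter fun C => (1 - ε) * (T.card * C.card) ≤ ((T * C).card : ℝ)) Finset.card
    ⟨∅, by simp⟩
  simp only [Finset.mem_filter, Finset.mem_powerset] at hC hmax
  refine ⟨C, hC.1, hC.2, ?_⟩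
  have hmeet : ∀ c ∈ S, ε * T.card ≤ ((T * {c}) ∩ (T * C)).card := by
    intro c hc
    by_cases hcC : c ∈ C
    · rw [Finset.inter_eq_left.2 (Finset.mul_subset_mul_left (Finset.singleton_subset_iff.2 hcC)),
        Finset.card_mul_singleton]
      exact mul_le_of_le_one_left (Nat.cast_nonneg _) hε1
    by_contra! hlt
    have hunion : ((T * insert c C).card : ℝ) + ((T * {c}) ∩ (T * C)).card
        = T.card + (T * C).card := by
      rw [Finset.insert_eq, Finset.mul_union, ← Finset.card_mul_singleton T c]
      exact_mod_cast Finset.card_union_add_card_inter (T * {c}) (T * C)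
    have := hmax (insert c C) ⟨Finset.insert_subset hc hC.1, by
      rw [Finset.card_insert_of_notMem hcC]
      push_cast
      linarith [hC.2]⟩
    rw [Finset.card_insert_of_notMem hcC] at this
    omega
  have hTpos : (0 : ℝ) < T.card := by exact_mod_cast hT.card_pos
  refine le_of_mul_le_mul_right ?_ hTpos
  calc ε * S.card * T.card = ∑ _c ∈ S, ε * (T.card : ℝ) := by
        rw [Finset.sum_const, nsmul_eq_mul]; ring
    _ ≤ ∑ c ∈ S, (((T * {c}) ∩ (T * C)).card : ℝ) := Finset.sum_le_sum hmeet
    _ ≤ (T * C).card * T.card := by exact_mod_cast sum_card_mul_singleton_inter_le T S (T * C)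

theorem exists_almost_disjoint_translates_subset {T F : Finset Γ} {ε : ℝ} (hT : T.Nonempty)
    (hF : F ∈ invariantSets T (1 / 2)) (hε : 0 < ε) (hε1 : ε ≤ 1) :
    ∃ C, T * C ⊆ F ∧ (1 - ε) * (T.card * C.card) ≤ (T * C).card ∧
      ((F \ (T * C)).card : ℝ) ≤ (1 - ε / 2) * F.card := by
  obtain ⟨C, hC, hdisj, hlarge⟩ := exists_almost_disjoint_translates (core T F) hT hε1
  have hsub : T * C ⊆ F := by
    refine Finset.mul_subset_iff.2 fun t ht c hc => ?_
    exact (Finset.mem_filter.1 (hC hc)).2 t ht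
  refine ⟨C, hsub, hdisj, ?_⟩
  have hcore := mul_le_mul_of_nonneg_left (mem_invariantSets.1 hF).2 hε.le
  rw [Finset.cast_card_sdiff hsub]
  linarith

end Core

theorem invariantSets_anti {K K' : Finset Γ} {δ δ' : ℝ} (hK : K ⊆ K') (hδ : δ' ≤ δ) :
    invariantSets K' δ' ⊆ invariantSets K δ := by
  classical
  intro F hF
  rw [mem_invariantSets] at hF ⊢
  have hcore : core K' F ⊆ core K F := Finset.monotone_filter_right _ fun t _ h k hk => h k (hK hk)
  refine ⟨hF.1, le_trans ?_ (hF.2.trans (by exact_mod_cast Finset.card_le_card hcore))⟩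
  gcongr

variable (Γ) in
theorem hasBasis_invariantFilter :
    (invariantFilter Γ).HasBasis (fun p : Finset Γ × ℝ => p.1.Nonempty ∧ 0 < p.2)
      (fun p => invariantSets p.1 p.2) := by
  classical
  have h : invariantFilter Γ = ⨅ p ∈ {p : Finset Γ × ℝ | p.1.Nonempty ∧ 0 < p.2},
      𝓟 (invariantSets p.1 p.2) := by
    simp only [invariantFilter, Set.mem_ofPred_eq, iInf_prod, iInf_and]
    exact iInf_congr fun K => iInf_comm
  rw [h]
  refine hasBasis_biInf_principal ?_ ⟨({1}, 1), by simp⟩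
  rintro ⟨K, δ⟩ ⟨hK, hδ⟩ ⟨K', δ'⟩ ⟨_, hδ'⟩
  exact ⟨(K ∪ K', min δ δ'), ⟨hK.mono Finset.subset_union_left, lt_min hδ hδ'⟩,
    invariantSets_anti Finset.subset_union_left (min_le_left _ _),
    invariantSets_anti Finset.subset_union_right (min_le_right _ _)⟩

theorem invariantSets_mem_invariantFilter {K : Finset Γ} (hK : K.Nonempty) {δ : ℝ} (hδ : 0 < δ) :
    invariantSets K δ ∈ invariantFilter Γ :=
  (hasBasis_invariantFilter Γ).mem_of_mem (i := (K, δ)) ⟨hK, hδ⟩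

variable (Γ) in
theorem eventually_nonempty : ∀ᶠ F in invariantFilter Γ, F.Nonempty :=
  mem_of_superset (invariantSets_mem_invariantFilter (Finset.singleton_nonempty 1) one_pos)
    fun _ hF => hF.1

theorem IsAmenable.neBot (h : IsAmenable Γ) : (invariantFilter Γ).NeBot :=
  (hasBasis_invariantFilter Γ).neBot_iff.2 fun {p} hp => h p.1 hp.1 p.2 hp.2

variable [DecidableEq Γ]

/-- `QuasiTiling ε 𝒯 F R`: removing from `F` one after another finitely many sets `T * C`, each a
union of `ε`-disjoint right translates of a tile `T ∈ 𝒯` that lies in what is still left, leaves the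
remainder `R`. -/
inductive QuasiTiling (ε : ℝ) (𝒯 : Set (Finset Γ)) : Finset Γ → Finset Γ → Prop
  | refl (F : Finset Γ) : QuasiTiling ε 𝒯 F F
  | remove {F R T C : Finset Γ} (mem : T ∈ 𝒯) (subset : T * C ⊆ F)
      (almost_disjoint : (1 - ε) * (T.card * C.card) ≤ ((T * C).card : ℝ))
      (rest : QuasiTiling ε 𝒯 (F \ (T * C)) R) : QuasiTiling ε 𝒯 F R

theorem QuasiTiling.mono {ε : ℝ} {𝒯 𝒯' : Set (Finset Γ)} {F R : Finset Γ} (h𝒯 : 𝒯 ⊆ 𝒯')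
    (h : QuasiTiling ε 𝒯 F R) : QuasiTiling ε 𝒯' F R := by
  induction h with
  | refl F => exact .refl F
  | remove mem subset almost_disjoint _ ih => exact .remove (h𝒯 mem) subset almost_disjoint ih

theorem exists_quasiTiling_card_le_max_pow {P : Finset Γ → Prop}
    (hP : ∃ᶠ F in invariantFilter Γ, P F) {ε : ℝ} (hε : 0 < ε) (hε1 : ε < 1) (n : ℕ) :
    ∃ 𝒯 : Finset (Finset Γ), (∀ T ∈ 𝒯, P T) ∧ ∀ᶠ F in invariantFilter Γ,
      ∃ R, QuasiTiling ε 𝒯 F R ∧ (R.card : ℝ) ≤ max ε ((1 - ε / 2) ^ n) * F.card := by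
  induction n with
  | zero =>
    refine ⟨∅, by simp, .of_forall fun F => ⟨F, .refl F, ?_⟩⟩
    exact le_mul_of_one_le_left (Nat.cast_nonneg _) (by simp)
  | succ n ih =>
    obtain ⟨𝒯, h𝒯, hev⟩ := ih
    obtain ⟨⟨K, δ⟩, ⟨hK, hδ⟩, hKδ⟩ := (hasBasis_invariantFilter Γ).eventually_iff.1 hev
    have hη : 0 < δ * ε * (1 - ε) / (2 * K.card) :=
      div_pos (mul_pos (mul_pos hδ hε) (sub_pos.2 hε1)) (by simpa using hK)
    obtain ⟨T, hPT, hT⟩ :=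
      (hP.and_eventually (invariantSets_mem_invariantFilter hK.inv hη)).exists
    refine ⟨insert T 𝒯, by simpa using ⟨hPT, h𝒯⟩, ?_⟩
    filter_upwards [invariantSets_mem_invariantFilter hK (by positivity : 0 < δ * ε / 2),
      invariantSets_mem_invariantFilter hT.1 one_half_pos] with F hFK hFT
    obtain ⟨C, hsub, hdisj, hcard⟩ :=
      exists_almost_disjoint_translates_subset hT.1 hFT hε hε1.le
    have hmem : T ∈ (insert T 𝒯 : Finset (Finset Γ)) := Finset.mem_insert_self T 𝒯
    rcases le_or_gt ((F \ (T * C)).card : ℝ) (ε * F.card) with hsmall | hlarge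
    · refine ⟨_, .remove hmem hsub hdisj (.refl _), hsmall.trans ?_⟩
      gcongr
      exact le_max_left _ _
    obtain ⟨R, hR, hRcard⟩ := hKδ (sdiff_mul_mem_invariantSets hK hδ hε hFK hT hdisj hsub hlarge)
    refine ⟨R, .remove hmem hsub hdisj (hR.mono (by simp)), hRcard.trans ?_⟩
    have hmax : max ε ((1 - ε / 2) ^ n) * (1 - ε / 2) ≤ max ε ((1 - ε / 2) ^ (n + 1)) := by
      rw [max_mul_of_nonneg _ _ (by linarith), ← pow_succ]
      exact max_le_max_right _ (mul_le_of_le_one_right hε.le (by linarith))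
    calc max ε ((1 - ε / 2) ^ n) * (F \ (T * C)).card
        ≤ max ε ((1 - ε / 2) ^ n) * ((1 - ε / 2) * F.card) := by gcongr
      _ = max ε ((1 - ε / 2) ^ n) * (1 - ε / 2) * F.card := by ring
      _ ≤ max ε ((1 - ε / 2) ^ (n + 1)) * F.card := by gcongr

theorem exists_quasiTiling {P : Finset Γ → Prop} (hP : ∃ᶠ F in invariantFilter Γ, P F) {ε : ℝ}
    (hε : 0 < ε) (hε1 : ε < 1) :
    ∃ 𝒯 : Finset (Finset Γ), (∀ T ∈ 𝒯, P T) ∧ ∀ᶠ F in invariantFilter Γ,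
      ∃ R, QuasiTiling ε 𝒯 F R ∧ (R.card : ℝ) ≤ ε * F.card := by
  obtain ⟨n, hn⟩ := exists_pow_lt_of_lt_one hε (show 1 - ε / 2 < 1 by linarith)
  simpa only [max_eq_left hn.le] using exists_quasiTiling_card_le_max_pow hP hε hε1 n

/-- Subadditive functions of the finite subsets of `Γ` that are invariant under right translation:
the functions to which the Ornstein–Weiss lemma applies. -/
structure IsInvariantSubadditive (φ : Finset Γ → ℝ) : Prop where
  empty : φ ∅ = 0
  union_le : ∀ A B, φ (A ∪ B) ≤ φ A + φ B
  mul_singleton : ∀ A c, φ (A * {c}) = φ A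

namespace IsInvariantSubadditive

variable {φ : Finset Γ → ℝ}

theorem mul_le (h : IsInvariantSubadditive φ) (T C : Finset Γ) : φ (T * C) ≤ C.card * φ T := by
  induction C using Finset.induction_on with
  | empty => simp [h.empty]
  | insert c C hc ih =>
    calc φ (T * insert c C) ≤ φ (T * {c}) + φ (T * C) := by
          rw [Finset.insert_eq, Finset.mul_union]; exact h.union_le _ _
      _ ≤ φ T + C.card * φ T := by rw [h.mul_singleton]; gcongr
      _ = (insert c C).card * φ T := by rw [Finset.card_insert_of_notMem hc]; push_cast; ring

theorem le_mul_card (h : IsInvariantSubadditive φ) (A : Finset Γ) : φ A ≤ φ {1} * A.card := by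
  have hle := h.mul_le {1} A
  rwa [Finset.singleton_one, one_mul, mul_comm] at hle

theorem le_of_quasiTiling (h : IsInvariantSubadditive φ) {ε a : ℝ} (hε1 : ε < 1) (ha : 0 ≤ a)
    {𝒯 : Set (Finset Γ)} (h𝒯 : ∀ T ∈ 𝒯, φ T ≤ a * T.card) {F R : Finset Γ}
    (hFR : QuasiTiling ε 𝒯 F R) : φ F ≤ a / (1 - ε) * F.card + φ R := by
  have hε : 0 < 1 - ε := sub_pos.2 hε1
  induction hFR with
  | refl F => exact le_add_of_nonneg_left (by positivity)
  | @remove F R T C mem subset almost_disjoint _ ih =>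
    have htiles : φ (T * C) ≤ a / (1 - ε) * (T * C).card :=
      calc φ (T * C) ≤ C.card * φ T := h.mul_le T C
        _ ≤ C.card * (a * T.card) := by gcongr; exact h𝒯 T mem
        _ = a / (1 - ε) * ((1 - ε) * (T.card * C.card)) := by field_simp
        _ ≤ a / (1 - ε) * (T * C).card := by gcongr
    calc φ F ≤ φ (T * C) + φ (F \ (T * C)) := by
          simpa only [Finset.union_sdiff_of_subset subset] using h.union_le (T * C) (F \ (T * C))
      _ ≤ a / (1 - ε) * (T * C).card + (a / (1 - ε) * (F \ (T * C)).card + φ R) :=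
          add_le_add htiles ih
      _ = a / (1 - ε) * F.card + φ R := by rw [Finset.cast_card_sdiff subset]; ring

end IsInvariantSubadditive

/-- The tiles do not depend on `φ`: they may be chosen first, and `φ` in terms of them. -/
theorem exists_tiles_forall_le_mul_card {P : Finset Γ → Prop}
    (hP : ∃ᶠ F in invariantFilter Γ, P F) {a a' b : ℝ} (ha : 0 ≤ a) (haa' : a < a') (hb : 0 ≤ b) :
    ∃ 𝒯 : Finset (Finset Γ), (∀ T ∈ 𝒯, P T) ∧ ∀ᶠ F in invariantFilter Γ,
      ∀ φ : Finset Γ → ℝ, IsInvariantSubadditive φ → φ {1} ≤ b →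
        (∀ T ∈ 𝒯, φ T ≤ a * T.card) → φ F ≤ a' * F.card := by
  obtain ⟨ε, hεa', hε, hε1⟩ : ∃ ε : ℝ, a / (1 - ε) + b * ε < a' ∧ 0 < ε ∧ ε < 1 := by
    have hcont : ContinuousAt (fun ε : ℝ => a / (1 - ε) + b * ε) 0 := by
      refine ContinuousAt.add (ContinuousAt.div ?_ ?_ (by norm_num)) ?_ <;> fun_prop
    have hlt : ∀ᶠ ε in 𝓝[>] (0 : ℝ), a / (1 - ε) + b * ε < a' :=
      (hcont.eventually_lt_const (by simpa using haa')).filter_mono nhdsWithin_le_nhds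
    exact (hlt.and (Ioo_mem_nhdsGT one_pos)).exists
  obtain ⟨𝒯, h𝒯, hev⟩ := exists_quasiTiling hP hε hε1
  refine ⟨𝒯, h𝒯, hev.mono ?_⟩
  rintro F ⟨R, hFR, hR⟩ φ hφ hφb hφ𝒯
  calc φ F ≤ a / (1 - ε) * F.card + φ R := hφ.le_of_quasiTiling hε1 ha hφ𝒯 hFR
    _ ≤ a / (1 - ε) * F.card + φ {1} * R.card := by gcongr; exact hφ.le_mul_card R
    _ ≤ a / (1 - ε) * F.card + b * (ε * F.card) := by gcongr
    _ = (a / (1 - ε) + b * ε) * F.card := by ring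
    _ ≤ a' * F.card := by gcongr

end OrnsteinWeiss

section Staircase

theorem card_le_of_isChain_prod {α β : Type*} [LinearOrder α] [LinearOrder β] {A : Finset α}
    {B : Finset β} {S : Finset (α × β)} (hS : S ⊆ A ×ˢ B)
    (hchain : IsChain (· ≤ ·) (S : Set (α × β))) : S.card ≤ A.card + B.card - 1 := by
  set rank : α × β → ℕ := fun z =>
    (A.filter (· < z.1)).card + (B.filter (· < z.2)).card with hrank
  have hA {a : α} (ha : a ∈ A) : (A.filter (· < a)).card < A.card :=
    Finset.card_lt_card (Finset.filter_ssubset.2 ⟨a, ha, lt_irrefl a⟩)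
  have hB {b : β} (hb : b ∈ B) : (B.filter (· < b)).card < B.card :=
    Finset.card_lt_card (Finset.filter_ssubset.2 ⟨b, hb, lt_irrefl b⟩)
  have hlt : ∀ z ∈ S, rank z < A.card + B.card - 1 := by
    intro z hz
    obtain ⟨hzA, hzB⟩ := Finset.mem_product.1 (hS hz)
    have := hA hzA
    have := hB hzB
    simp only [hrank]
    omega
  have hmono : ∀ z ∈ S, ∀ z', z < z' → rank z < rank z' := by
    intro z hz z' hzz'
    obtain ⟨hzA, hzB⟩ := Finset.mem_product.1 (hS hz)
    have hle₁ : A.filter (· < z.1) ⊆ A.filter (· < z'.1) :=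
      Finset.monotone_filter_right _ fun a _ h => h.trans_le hzz'.le.1
    have hle₂ : B.filter (· < z.2) ⊆ B.filter (· < z'.2) :=
      Finset.monotone_filter_right _ fun b _ h => h.trans_le hzz'.le.2
    rcases Prod.lt_iff.1 hzz' with ⟨h, _⟩ | ⟨_, h⟩
    · refine add_lt_add_of_lt_of_le (Finset.card_lt_card ?_) (Finset.card_le_card hle₂)
      exact (Finset.ssubset_iff_of_subset hle₁).2 ⟨z.1, by simp [hzA, h], by simp⟩
    · refine add_lt_add_of_le_of_lt (Finset.card_le_card hle₁) (Finset.card_lt_card ?_)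
      exact (Finset.ssubset_iff_of_subset hle₂).2 ⟨z.2, by simp [hzB, h], by simp⟩
  have hinj : Set.InjOn rank S := by
    intro z hz z' hz' h
    by_contra hne
    rcases hchain hz hz' hne with hle | hle
    · exact (hmono z hz z' (lt_of_le_of_ne hle hne)).ne h
    · exact (hmono z' hz' z (lt_of_le_of_ne hle (Ne.symm hne))).ne' h
  simpa using Finset.card_le_card_of_injOn rank (t := Finset.range (A.card + B.card - 1))
    (fun z hz => by simpa using hlt z hz) hinj

variable {ι κ : Type*} [Fintype ι] [LinearOrder ι] [Fintype κ] [LinearOrder κ]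

/-- Lay intervals of lengths `u i` and, independently, intervals of lengths `v j` end to end,
starting at `0`. `Overlap u v (i, j)` says that the `i`-th interval of the first kind and the `j`-th
of the second kind have a common interior point. -/
def Overlap (u : ι → ℝ) (v : κ → ℝ) (z : ι × κ) : Prop :=
  0 < u z.1 ∧ 0 < v z.2 ∧ ∑ i with i < z.1, u i < ∑ j with j ≤ z.2, v j ∧
    ∑ j with j < z.2, v j < ∑ i with i ≤ z.1, u i

variable {u : ι → ℝ} {v : κ → ℝ}

theorem sum_filter_le_le_sum_filter_lt (hu : ∀ i, 0 ≤ u i) {i i' : ι} (h : i < i') :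
    ∑ k with k ≤ i, u k ≤ ∑ k with k < i', u k :=
  Finset.sum_le_sum_of_subset_of_nonneg
    (Finset.monotone_filter_right _ fun _ _ hk => lt_of_le_of_lt hk h) fun k _ _ => hu k

theorem Overlap.snd_le_of_fst_lt (hu : ∀ i, 0 ≤ u i) (hv : ∀ j, 0 ≤ v j) {z z' : ι × κ}
    (hz : Overlap u v z) (hz' : Overlap u v z') (h : z.1 < z'.1) : z.2 ≤ z'.2 := by
  by_contra! hlt
  have hleft := sum_filter_le_le_sum_filter_lt hu h
  have hright := sum_filter_le_le_sum_filter_lt hv hlt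
  linarith [hz.2.2.2, hz'.2.2.1]

theorem isChain_overlap (hu : ∀ i, 0 ≤ u i) (hv : ∀ j, 0 ≤ v j) :
    IsChain (· ≤ ·) {z | Overlap u v z} := by
  intro z hz z' hz' _
  rcases lt_trichotomy z.1 z'.1 with h | h | h
  · exact .inl ⟨h.le, hz.snd_le_of_fst_lt hu hv hz' h⟩
  · exact (le_total z.2 z'.2).imp (fun h' => ⟨h.le, h'⟩) fun h' => ⟨h.ge, h'⟩
  · exact .inr ⟨h.le, hz'.snd_le_of_fst_lt hu hv hz h⟩

theorem ncard_overlap_le (hu : ∀ i, 0 ≤ u i) (hv : ∀ j, 0 ≤ v j) :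
    {z | Overlap u v z}.ncard ≤ {i | 0 < u i}.ncard + {j | 0 < v j}.ncard - 1 := by
  classical
  simp only [Set.ncard_eq_toFinset_card']
  refine card_le_of_isChain_prod (fun z hz => ?_) (by simpa using isChain_overlap hu hv)
  have hz : Overlap u v z := by simpa using hz
  simpa using ⟨hz.1, hz.2.1⟩

theorem exists_pos_sum_filter_lt_eq_zero (hu : ∀ i, 0 ≤ u i) (hsum : 0 < ∑ i, u i) :
    ∃ i, 0 < u i ∧ ∑ k with k < i, u k = 0 := by
  obtain ⟨i₀, _, hi₀⟩ := Finset.exists_lt_of_sum_lt (by simpa using hsum :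
    ∑ _i : ι, (0 : ℝ) < ∑ i, u i)
  obtain ⟨i, hi, hmin⟩ := WellFounded.has_min (wellFounded_lt (α := ι)) {i | 0 < u i} ⟨i₀, hi₀⟩
  refine ⟨i, hi, Finset.sum_eq_zero fun k hk => ?_⟩
  exact le_antisymm (not_lt.1 fun h => hmin k h (Finset.mem_filter.1 hk).2) (hu k)

theorem exists_overlap (hu : ∀ i, 0 ≤ u i) (hv : ∀ j, 0 ≤ v j) (husum : 0 < ∑ i, u i)
    (hvsum : 0 < ∑ j, v j) : ∃ z, Overlap u v z := by
  obtain ⟨i, hi, hi₀⟩ := exists_pos_sum_filter_lt_eq_zero hu husum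
  obtain ⟨j, hj, hj₀⟩ := exists_pos_sum_filter_lt_eq_zero hv hvsum
  refine ⟨(i, j), hi, hj, ?_, ?_⟩
  · rw [hi₀]; exact Finset.sum_pos' (fun k _ => hv k) ⟨j, by simp, hj⟩
  · rw [hj₀]; exact Finset.sum_pos' (fun k _ => hu k) ⟨i, by simp, hi⟩

theorem isOpen_setOf_overlap {X : Type*} [TopologicalSpace X] {f : ι → X → ℝ} {g : κ → X → ℝ}
    (hf : ∀ i, Continuous (f i)) (hg : ∀ j, Continuous (g j)) (z : ι × κ) :
    IsOpen {x | Overlap (f · x) (g · x) z} := by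
  have hsum_f (p : ι → Prop) [DecidablePred p] : Continuous fun x => ∑ i with p i, f i x :=
    continuous_finsetSum _ fun i _ => hf i
  have hsum_g (p : κ → Prop) [DecidablePred p] : Continuous fun x => ∑ j with p j, g j x :=
    continuous_finsetSum _ fun j _ => hg j
  exact (isOpen_lt continuous_const (hf z.1)).and <| (isOpen_lt continuous_const (hg z.2)).and <|
    (isOpen_lt (hsum_f _) (hsum_g _)).and (isOpen_lt (hsum_g _) (hsum_f _))

end Staircase

section Order

variable {X Y : Type*}

theorem ord_le_iff {𝒲 : Set (Set X)} (h : 𝒲.Finite) {n : ℕ} :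
    ord 𝒲 ≤ n ↔ ∀ x, {W | W ∈ 𝒲 ∧ x ∈ W}.ncard ≤ n + 1 := by
  have hbdd : BddAbove (Set.range fun x : X => {W | W ∈ 𝒲 ∧ x ∈ W}.ncard) :=
    ⟨𝒲.ncard, Set.forall_mem_range.2 fun x => Set.ncard_le_ncard (fun W hW => hW.1) h⟩
  rw [ord, Nat.sub_le_iff_le_add]
  exact ⟨fun hle x => (le_ciSup hbdd x).trans hle, ciSup_le'⟩

theorem ncard_le_ord_add_one {𝒲 : Set (Set X)} (h : 𝒲.Finite) (x : X) :
    {W | W ∈ 𝒲 ∧ x ∈ W}.ncard ≤ ord 𝒲 + 1 :=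
  (ord_le_iff h).1 le_rfl x

theorem ncard_setOf_mem_le_ord_add_one {𝒲 : Set (Set X)} (h : 𝒲.Finite) {P : 𝒲 → Prop} {x : X}
    (hP : ∀ W, P W → x ∈ (W : Set X)) : {W | P W}.ncard ≤ ord 𝒲 + 1 := by
  rw [← Set.ncard_image_of_injective _ Subtype.val_injective]
  refine (Set.ncard_le_ncard ?_ (h.subset fun _ hW => hW.1)).trans (ncard_le_ord_add_one h x)
  rintro _ ⟨W, hW, rfl⟩
  exact ⟨W.2, hP W hW⟩

theorem ord_range_le {ι : Type*} [Finite ι] {W : ι → Set X} {n : ℕ}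
    (h : ∀ x, {i | x ∈ W i}.ncard ≤ n + 1) : ord (Set.range W) ≤ n := by
  refine (ord_le_iff (Set.finite_range W)).2 fun x => le_trans ?_ (h x)
  have hsub : {V | V ∈ Set.range W ∧ x ∈ V} ⊆ W '' {i | x ∈ W i} := by
    rintro _ ⟨⟨i, rfl⟩, hx⟩
    exact ⟨i, hx, rfl⟩
  exact (Set.ncard_le_ncard hsub (Set.toFinite _)).trans (Set.ncard_image_le (Set.toFinite _))

theorem ord_preimage_le {𝒱 : Set (Set Y)} (h : 𝒱.Finite) (f : X → Y) :
    ord (Set.preimage f '' 𝒱) ≤ ord 𝒱 := by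
  have : Finite 𝒱 := h
  rw [Set.image_eq_range]
  exact ord_range_le fun x => ncard_setOf_mem_le_ord_add_one h (x := f x) fun _ hx => hx

theorem ord_singleton (A : Set X) : ord {A} = 0 :=
  Nat.le_zero.1 <| (ord_le_iff (Set.finite_singleton A)).2 fun x =>
    (Set.ncard_le_ncard (fun _ hW => hW.1) (Set.finite_singleton A)).trans (by simp)

end Order

section Refines

variable {X Y Z : Type*} {𝒜 𝒜' ℬ ℬ' 𝒞 : Set (Set X)}

theorem Refines.of_subset (h : 𝒜 ⊆ ℬ) : Refines 𝒜 ℬ := fun A hA => ⟨A, h hA, subset_rfl⟩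

theorem Refines.refl (𝒜 : Set (Set X)) : Refines 𝒜 𝒜 := .of_subset subset_rfl

theorem Refines.trans (h : Refines 𝒜 ℬ) (h' : Refines ℬ 𝒞) : Refines 𝒜 𝒞 := fun A hA => by
  obtain ⟨B, hB, hAB⟩ := h A hA
  obtain ⟨C, hC, hBC⟩ := h' B hB
  exact ⟨C, hC, hAB.trans hBC⟩

theorem join_refines_left (𝒜 ℬ : Set (Set X)) : Refines (join 𝒜 ℬ) 𝒜 := by
  rintro _ ⟨A, hA, B, _, rfl⟩
  exact ⟨A, hA, Set.inter_subset_left⟩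

theorem join_refines_right (𝒜 ℬ : Set (Set X)) : Refines (join 𝒜 ℬ) ℬ := by
  rintro _ ⟨A, _, B, hB, rfl⟩
  exact ⟨B, hB, Set.inter_subset_right⟩

theorem Refines.join (h : Refines 𝒜 𝒜') (h' : Refines ℬ ℬ') :
    Refines (join 𝒜 ℬ) (join 𝒜' ℬ') := by
  rintro _ ⟨A, hA, B, hB, rfl⟩
  obtain ⟨A', hA', hAA'⟩ := h A hA
  obtain ⟨B', hB', hBB'⟩ := h' B hB
  exact ⟨_, ⟨A', hA', B', hB', rfl⟩, Set.inter_subset_inter hAA' hBB'⟩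

theorem Refines.image_preimage {𝒱 𝒲 : Set (Set Y)} (h : Refines 𝒱 𝒲) (f : X → Y) :
    Refines (Set.preimage f '' 𝒱) (Set.preimage f '' 𝒲) := by
  rintro _ ⟨V, hV, rfl⟩
  obtain ⟨W, hW, hVW⟩ := h V hV
  exact ⟨_, ⟨W, hW, rfl⟩, Set.preimage_mono hVW⟩

theorem join_image_preimage (f : X → Y) (𝒱 𝒲 : Set (Set Y)) :
    join (Set.preimage f '' 𝒱) (Set.preimage f '' 𝒲) = Set.preimage f '' join 𝒱 𝒲 := by
  simp only [join, Set.image_image2, Set.image2_image_left, Set.image2_image_right,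
    Set.preimage_inter]

theorem fibers_comp (f : X → Y) (g : Y → Z) :
    fibers (g ∘ f) = Set.preimage f '' fibers g := by
  simp only [fibers, ← Set.range_comp]
  rfl

end Refines

section Covers

variable {X Y : Type*} [TopologicalSpace X] [TopologicalSpace Y]

theorem isFinOpenCover_range {ι : Type*} [Finite ι] {W : ι → Set X} (ho : ∀ i, IsOpen (W i))
    (hc : ∀ x, ∃ i, x ∈ W i) : IsFinOpenCover (Set.range W) :=
  ⟨Set.finite_range W, Set.forall_mem_range.2 ho,
    Set.eq_univ_of_forall fun x => by simpa using hc x⟩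

theorem isFinOpenCover_univ : IsFinOpenCover ({Set.univ} : Set (Set X)) :=
  ⟨Set.finite_singleton _, by simp, by simp⟩

namespace IsFinOpenCover

variable {𝒰 𝒱 : Set (Set X)}

theorem exists_mem (h : IsFinOpenCover 𝒰) (x : X) : ∃ U ∈ 𝒰, x ∈ U :=
  Set.mem_sUnion.1 (h.sUnion_eq ▸ Set.mem_univ x)

theorem iUnion_eq (h : IsFinOpenCover 𝒰) : ⋃ U : 𝒰, (U : Set X) = Set.univ := by
  rw [← Set.sUnion_eq_iUnion, h.sUnion_eq]

theorem join (h𝒰 : IsFinOpenCover 𝒰) (h𝒱 : IsFinOpenCover 𝒱) : IsFinOpenCover (join 𝒰 𝒱) := by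
  refine ⟨h𝒰.finite.image2 _ h𝒱.finite, ?_, Set.eq_univ_of_forall fun x => ?_⟩
  · rintro _ ⟨U, hU, V, hV, rfl⟩
    exact (h𝒰.isOpen U hU).inter (h𝒱.isOpen V hV)
  · obtain ⟨U, hU, hxU⟩ := h𝒰.exists_mem x
    obtain ⟨V, hV, hxV⟩ := h𝒱.exists_mem x
    exact ⟨_, ⟨U, hU, V, hV, rfl⟩, hxU, hxV⟩

theorem preimage {𝒱 : Set (Set Y)} (h : IsFinOpenCover 𝒱) {f : X → Y} (hf : Continuous f) :
    IsFinOpenCover (Set.preimage f '' 𝒱) := by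
  refine ⟨h.finite.image _, ?_, Set.eq_univ_of_forall fun x => ?_⟩
  · rintro _ ⟨V, hV, rfl⟩
    exact (h.isOpen V hV).preimage hf
  · obtain ⟨V, hV, hx⟩ := h.exists_mem (f x)
    exact ⟨_, ⟨V, hV, rfl⟩, hx⟩

theorem exists_forall_refines {ι : Type*} (s : Finset ι) {𝒱 : ι → Set (Set X)}
    (h : ∀ i ∈ s, IsFinOpenCover (𝒱 i)) :
    ∃ 𝒲, IsFinOpenCover 𝒲 ∧ ∀ i ∈ s, Refines 𝒲 (𝒱 i) := by
  classical
  induction s using Finset.induction_on with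
  | empty => exact ⟨{Set.univ}, isFinOpenCover_univ, by simp⟩
  | insert i s _ ih =>
    rw [Finset.forall_mem_insert] at h
    obtain ⟨𝒲, h𝒲, href⟩ := ih h.2
    exact ⟨_, h.1.join h𝒲, (Finset.forall_mem_insert _ _ _).2 ⟨join_refines_left _ _,
      fun j hj => (join_refines_right _ _).trans (href j hj)⟩⟩

theorem exists_shrinking [NormalSpace X] (h : IsFinOpenCover 𝒰) :
    ∃ v : 𝒰 → Set X, IsFinOpenCover (Set.range v) ∧ ∀ U, closure (v U) ⊆ U := by
  have : Finite 𝒰 := h.finite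
  obtain ⟨v, hv, hvo, hvc⟩ := exists_iUnion_eq_closure_subset (u := fun U : 𝒰 => (U : Set X))
    (fun U => h.isOpen _ U.2) (fun _ => Set.toFinite _) h.iUnion_eq
  exact ⟨v, isFinOpenCover_range hvo (Set.iUnion_eq_univ_iff.1 hv), hvc⟩

theorem exists_subordinate_functions [NormalSpace X] (h : IsFinOpenCover 𝒰) [Fintype 𝒰] :
    ∃ f : 𝒰 → X → ℝ, (∀ U, Continuous (f U)) ∧ (∀ x U, 0 ≤ f U x) ∧ (∀ x, 0 < ∑ U, f U x) ∧
      ∀ U x, 0 < f U x → x ∈ (U : Set X) := by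
  obtain ⟨f, hf⟩ := PartitionOfUnity.exists_isSubordinate_of_locallyFinite isClosed_univ
    (fun U : 𝒰 => (U : Set X)) (fun U => h.isOpen U U.2) (locallyFinite_of_finite _)
    h.iUnion_eq.ge
  refine ⟨fun U => f U, fun U => (f U).continuous, fun x U => f.nonneg U x, fun x => ?_,
    fun U x hx => hf U (subset_tsupport _ hx.ne')⟩
  rw [← finsum_eq_sum_of_fintype, f.sum_eq_one (Set.mem_univ x)]
  exact one_pos

/-- Subordinate functions cut a segment, over each point, into consecutive intervals. The pairs of
overlapping intervals are monotone in both indices, hence there is one pair fewer than there are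
nondegenerate intervals altogether. -/
theorem exists_refines_refines_ord_le_add [NormalSpace X] (h𝒰 : IsFinOpenCover 𝒰)
    (h𝒱 : IsFinOpenCover 𝒱) :
    ∃ 𝒲, IsFinOpenCover 𝒲 ∧ Refines 𝒲 𝒰 ∧ Refines 𝒲 𝒱 ∧ ord 𝒲 ≤ ord 𝒰 + ord 𝒱 := by
  let _ := h𝒰.finite.fintype
  let _ := h𝒱.finite.fintype
  let _ : LinearOrder 𝒰 := IsWellOrder.linearOrder WellOrderingRel
  let _ : LinearOrder 𝒱 := IsWellOrder.linearOrder WellOrderingRel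
  obtain ⟨f, hf, hf0, hf_sum, hf_mem⟩ := h𝒰.exists_subordinate_functions
  obtain ⟨g, hg, hg0, hg_sum, hg_mem⟩ := h𝒱.exists_subordinate_functions
  refine ⟨Set.range fun z : 𝒰 × 𝒱 => {x | Overlap (f · x) (g · x) z}, isFinOpenCover_range
    (isOpen_setOf_overlap hf hg) fun x => exists_overlap (hf0 x) (hg0 x) (hf_sum x) (hg_sum x),
    ?_, ?_, ord_range_le fun x => ?_⟩
  · exact Set.forall_mem_range.2 fun z => ⟨z.1, z.1.2, fun x hx => hf_mem _ x hx.1⟩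
  · exact Set.forall_mem_range.2 fun z => ⟨z.2, z.2.2, fun x hx => hg_mem _ x hx.2.1⟩
  have hcard : {z | Overlap (f · x) (g · x) z}.ncard ≤ _ := ncard_overlap_le (hf0 x) (hg0 x)
  have hf_card := ncard_setOf_mem_le_ord_add_one h𝒰.finite fun U => hf_mem U x
  have hg_card := ncard_setOf_mem_le_ord_add_one h𝒱.finite fun V => hg_mem V x
  exact hcard.trans (by omega)

end IsFinOpenCover

end Covers

section RelativeOrder

variable {X Y Z : Type*} [TopologicalSpace X]

/-- The least order of a finite open cover whose joining with `𝒜` refines `𝒰`. For the fibers of a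
map this is `condD`; the chain rule involves the elements of covers as well. -/
noncomputable def relD (𝒜 𝒰 : Set (Set X)) : ℕ :=
  sInf {n | ∃ 𝒲 : Set (Set X), IsFinOpenCover 𝒲 ∧ Refines (join 𝒜 𝒲) 𝒰 ∧ ord 𝒲 = n}

theorem condD_eq_relD (π : X → Y) (𝒰 : Set (Set X)) : condD π 𝒰 = relD (fibers π) 𝒰 := rfl

theorem relD_le {𝒜 𝒰 𝒲 : Set (Set X)} (h𝒲 : IsFinOpenCover 𝒲) (h : Refines (join 𝒜 𝒲) 𝒰) :
    relD 𝒜 𝒰 ≤ ord 𝒲 :=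
  Nat.sInf_le ⟨𝒲, h𝒲, h, rfl⟩

theorem relD_le_ord (𝒜 : Set (Set X)) {𝒰 : Set (Set X)} (h : IsFinOpenCover 𝒰) :
    relD 𝒜 𝒰 ≤ ord 𝒰 :=
  relD_le h (join_refines_right _ _)

theorem exists_ord_eq_relD (𝒜 : Set (Set X)) {𝒰 : Set (Set X)} (h : IsFinOpenCover 𝒰) :
    ∃ 𝒲 : Set (Set X), IsFinOpenCover 𝒲 ∧ Refines (join 𝒜 𝒲) 𝒰 ∧ ord 𝒲 = relD 𝒜 𝒰 :=
  Nat.sInf_mem (s := {n | ∃ 𝒲 : Set (Set X), IsFinOpenCover 𝒲 ∧ Refines (join 𝒜 𝒲) 𝒰 ∧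
    ord 𝒲 = n}) ⟨ord 𝒰, 𝒰, h, join_refines_right _ _, rfl⟩

theorem relD_mono {𝒜 𝒜' 𝒰 𝒰' : Set (Set X)} (h𝒜 : Refines 𝒜' 𝒜) (h𝒰 : IsFinOpenCover 𝒰)
    (h : Refines 𝒰 𝒰') : relD 𝒜' 𝒰' ≤ relD 𝒜 𝒰 := by
  obtain ⟨𝒲, h𝒲, href, hord⟩ := exists_ord_eq_relD 𝒜 h𝒰
  exact hord ▸ relD_le h𝒲 (((h𝒜.join (.refl 𝒲)).trans href).trans h)

variable [TopologicalSpace Y]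

theorem relD_image_preimage_le {f : X → Y} (hf : Continuous f) (𝒜 : Set (Set Y)) {𝒱 : Set (Set Y)}
    (h𝒱 : IsFinOpenCover 𝒱) : relD (Set.preimage f '' 𝒜) (Set.preimage f '' 𝒱) ≤ relD 𝒜 𝒱 := by
  obtain ⟨𝒲, h𝒲, href, hord⟩ := exists_ord_eq_relD 𝒜 h𝒱
  refine hord ▸ (relD_le (h𝒲.preimage hf) ?_).trans (ord_preimage_le h𝒲.finite f)
  rw [join_image_preimage]
  exact href.image_preimage f

theorem relD_join_le_add [NormalSpace X] (𝒜 : Set (Set X)) {𝒰 𝒱 : Set (Set X)}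
    (h𝒰 : IsFinOpenCover 𝒰) (h𝒱 : IsFinOpenCover 𝒱) :
    relD 𝒜 (join 𝒰 𝒱) ≤ relD 𝒜 𝒰 + relD (join 𝒜 𝒰) 𝒱 := by
  obtain ⟨𝒲₁, h𝒲₁, href₁, hord₁⟩ := exists_ord_eq_relD 𝒜 h𝒰
  obtain ⟨𝒲₂, h𝒲₂, href₂, hord₂⟩ := exists_ord_eq_relD (join 𝒜 𝒰) h𝒱
  obtain ⟨𝒲, h𝒲, h₁, h₂, hord⟩ := h𝒲₁.exists_refines_refines_ord_le_add h𝒲₂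
  rw [hord₁, hord₂] at hord
  refine (relD_le h𝒲 ?_).trans hord
  rintro _ ⟨A, hA, W, hW, rfl⟩
  obtain ⟨W₁, hW₁, hWW₁⟩ := h₁ W hW
  obtain ⟨U, hU, hAU⟩ := href₁ _ ⟨A, hA, W₁, hW₁, rfl⟩
  obtain ⟨W₂, hW₂, hWW₂⟩ := h₂ W hW
  obtain ⟨V, hV, hAV⟩ := href₂ _ ⟨_, ⟨A, hA, U, hU, rfl⟩, W₂, hW₂, rfl⟩
  have hsub : A ∩ W ⊆ U := (Set.inter_subset_inter_right A hWW₁).trans hAU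
  exact ⟨_, ⟨U, hU, V, hV, rfl⟩, fun x hx => ⟨hsub hx, hAV ⟨⟨hx.1, hsub hx⟩, hWW₂ hx.2⟩⟩⟩

theorem condD_comp_le [NormalSpace X] {π : X → Y} (hπ : Continuous π) (ρ : Y → Z)
    {𝒰 : Set (Set X)} {𝒱 : Set (Set Y)} (h𝒰 : IsFinOpenCover 𝒰) (h𝒱 : IsFinOpenCover 𝒱) :
    condD (ρ ∘ π) 𝒰 ≤ condD ρ 𝒱 + relD (Set.preimage π '' 𝒱) 𝒰 := by
  set ℱ := Set.preimage π '' fibers ρ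
  have h𝒱' := h𝒱.preimage hπ
  calc condD (ρ ∘ π) 𝒰 = relD ℱ 𝒰 := by rw [condD_eq_relD, fibers_comp]
    _ ≤ relD ℱ (join (Set.preimage π '' 𝒱) 𝒰) :=
        relD_mono (.refl _) (h𝒱'.join h𝒰) (join_refines_right _ _)
    _ ≤ relD ℱ (Set.preimage π '' 𝒱) + relD (join ℱ (Set.preimage π '' 𝒱)) 𝒰 :=
        relD_join_le_add ℱ h𝒱' h𝒰
    _ ≤ condD ρ 𝒱 + relD (Set.preimage π '' 𝒱) 𝒰 :=
        add_le_add (relD_image_preimage_le hπ _ h𝒱)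
          (relD_mono (join_refines_right _ _) h𝒰 (.refl _))

/-- A cover that refines `𝒰` along single fibers does so, once it is shrunk, along the preimages of
small neighborhoods: `N y` consists of the points whose fibers meet `closure (v W)` inside
`U y W`, and is open because `π` is closed. -/
theorem exists_relD_image_preimage_le_condD [CompactSpace X] [NormalSpace X] [CompactSpace Y]
    [T2Space Y] {π : X → Y} (hπ : Continuous π) {𝒰 : Set (Set X)} (h𝒰 : IsFinOpenCover 𝒰) :
    ∃ 𝒱 : Set (Set Y), IsFinOpenCover 𝒱 ∧ relD (Set.preimage π '' 𝒱) 𝒰 ≤ condD π 𝒰 := by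
  obtain ⟨𝒲, h𝒲, href, hord⟩ := exists_ord_eq_condD π h𝒰
  have : Finite 𝒲 := h𝒲.finite
  obtain ⟨v, hv, hvW⟩ := h𝒲.exists_shrinking
  have hfiber (y : Y) (W : 𝒲) : ∃ U ∈ 𝒰, π ⁻¹' {y} ∩ W ⊆ U := href _ ⟨_, ⟨y, rfl⟩, W, W.2, rfl⟩
  choose U hU hyU using hfiber
  set N : Y → Set Y := fun y => ⋂ W : 𝒲, (π '' (closure (v W) \ U y W))ᶜ
  have hN_open (y : Y) : IsOpen (N y) := isOpen_iInter_of_finite fun W =>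
    (hπ.isClosedMap _ (isClosed_closure.sdiff (h𝒰.isOpen _ (hU y W)))).isOpen_compl
  have hN_mem (y : Y) : y ∈ N y := by
    refine Set.mem_iInter.2 fun W => ?_
    rintro ⟨x, ⟨hxW, hxU⟩, rfl⟩
    exact hxU (hyU _ W ⟨rfl, hvW W hxW⟩)
  have hN_sub (y : Y) (W : 𝒲) : π ⁻¹' N y ∩ v W ⊆ U y W := fun x hx => by
    by_contra hxU
    exact Set.mem_iInter.1 hx.1 W ⟨x, ⟨subset_closure hx.2, hxU⟩, rfl⟩
  obtain ⟨t, ht⟩ := CompactSpace.elim_nhds_subcover N fun y => (hN_open y).mem_nhds (hN_mem y)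
  refine ⟨Set.range fun y : t => N y, isFinOpenCover_range (fun y => hN_open y) fun x => ?_, ?_⟩
  · simpa using (ht ▸ Set.mem_univ x : x ∈ ⋃ y ∈ t, N y)
  refine (relD_le hv ?_).trans (hord ▸ ord_range_le fun x => ?_)
  · rintro _ ⟨_, ⟨_, ⟨y, rfl⟩, rfl⟩, _, ⟨W, rfl⟩, rfl⟩
    exact ⟨_, hU y W, hN_sub y W⟩
  · exact ncard_setOf_mem_le_ord_add_one h𝒲.finite fun W hx => hvW W (subset_closure hx)

end RelativeOrder

section CoverPow

open scoped Pointwise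

variable {Γ X Y : Type*} [Group Γ] [MulAction Γ X] [MulAction Γ Y]

theorem coverPow_refines_of_subset (𝒰 : Set (Set X)) {F F' : Finset Γ} (h : F ⊆ F') :
    Refines (coverPow 𝒰 F') (coverPow 𝒰 F) := by
  rintro _ ⟨U, hU, rfl⟩
  exact ⟨_, ⟨U, fun s hs => hU s (h hs), rfl⟩, Set.biInter_subset_biInter_left h⟩

theorem coverPow_refines_image_preimage (𝒰 : Set (Set X)) {F : Finset Γ} {t : Γ} (ht : t ∈ F) :
    Refines (coverPow 𝒰 F) (Set.preimage (t • · : X → X) '' 𝒰) := by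
  rintro _ ⟨U, hU, rfl⟩
  exact ⟨_, ⟨U t, hU t ht, rfl⟩, Set.biInter_subset_of_mem ht⟩

theorem join_coverPow_refines [DecidableEq Γ] (𝒰 : Set (Set X)) (F F' : Finset Γ) :
    Refines (join (coverPow 𝒰 F) (coverPow 𝒰 F')) (coverPow 𝒰 (F ∪ F')) := by
  rintro _ ⟨_, ⟨U, hU, rfl⟩, _, ⟨U', hU', rfl⟩, rfl⟩
  have hF' {s : Γ} (hs : s ∈ F ∪ F') (h : s ∉ F) : s ∈ F' := (Finset.mem_union.1 hs).resolve_left h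
  refine ⟨_, ⟨fun s => if s ∈ F then U s else U' s, fun s hs => ?_, rfl⟩,
    fun x hx => Set.mem_iInter₂.2 fun s hs => ?_⟩
  · dsimp only
    split_ifs with h
    exacts [hU s h, hU' s (hF' hs h)]
  · dsimp only
    split_ifs with h
    exacts [Set.mem_iInter₂.1 hx.1 s h, Set.mem_iInter₂.1 hx.2 s (hF' hs h)]

theorem coverPow_mul_singleton [DecidableEq Γ] (𝒰 : Set (Set X)) (F : Finset Γ) (c : Γ) :
    coverPow 𝒰 (F * {c}) = Set.preimage (c • · : X → X) '' coverPow 𝒰 F := by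
  have hinter (U : Γ → Set X) : ⋂ s ∈ F * {c}, (s • · : X → X) ⁻¹' U s =
      (c • · : X → X) ⁻¹' ⋂ s ∈ F, (s • · : X → X) ⁻¹' U (s * c) := by
    ext x
    simp [Finset.mem_mul, mul_smul]
  apply Set.Subset.antisymm
  · rintro _ ⟨U, hU, rfl⟩
    refine ⟨_, ⟨fun s => U (s * c), fun s hs => hU _ ?_, rfl⟩, (hinter U).symm⟩
    exact Finset.mul_mem_mul hs (Finset.mem_singleton_self c)
  · rintro _ ⟨_, ⟨U, hU, rfl⟩, rfl⟩
    refine ⟨fun s => U (s * c⁻¹), ?_, ?_⟩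
    · simpa [Finset.mem_mul] using hU
    · simp_rw [hinter, mul_inv_cancel_right]

theorem exists_coverPow_refines [TopologicalSpace X] [ContinuousConstSMul Γ X]
    {𝒯 : Finset (Finset Γ)} (h𝒯 : ∀ T ∈ 𝒯, T.Nonempty) {𝒰 : Finset Γ → Set (Set X)}
    (h𝒰 : ∀ T ∈ 𝒯, IsFinOpenCover (𝒰 T)) :
    ∃ 𝒲 : Set (Set X), IsFinOpenCover 𝒲 ∧ ∀ T ∈ 𝒯, Refines (coverPow 𝒲 T) (𝒰 T) := by
  choose! t ht using h𝒯
  obtain ⟨𝒲, h𝒲, href⟩ := IsFinOpenCover.exists_forall_refines 𝒯 fun T hT =>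
    (h𝒰 T hT).preimage (continuous_const_smul (t T)⁻¹)
  refine ⟨𝒲, h𝒲, fun T hT => ?_⟩
  have hcancel : Set.preimage (t T • · : X → X) '' (Set.preimage ((t T)⁻¹ • · : X → X) '' 𝒰 T)
      = 𝒰 T := by
    simp [Set.image_image, ← Set.preimage_comp, Function.comp_def]
  exact hcancel ▸ (coverPow_refines_image_preimage 𝒲 (ht T hT)).trans
    ((href T hT).image_preimage _)

/-- Families of subsets indexed by the finite subsets `F` of `Γ`, finer for larger `F` and
compatible with right translation of `F`: the families relative to which the order of `𝒰^F` is
subadditive in `F`. -/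
structure IsEquivariantFamily [DecidableEq Γ] (𝒜 : Finset Γ → Set (Set X)) : Prop where
  refines_of_subset : ∀ {F F' : Finset Γ}, F ⊆ F' → Refines (𝒜 F') (𝒜 F)
  mul_singleton_refines : ∀ (F : Finset Γ) (c : Γ),
    Refines (𝒜 (F * {c})) (Set.preimage (c • · : X → X) '' 𝒜 F)

variable [DecidableEq Γ]

theorem isEquivariantFamily_fibers {π : X → Y} (hequiv : ∀ (s : Γ) (x : X), π (s • x) = s • π x) :
    IsEquivariantFamily fun _ : Finset Γ => fibers π where
  refines_of_subset _ := .refl _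
  mul_singleton_refines := by
    rintro _ c _ ⟨y, rfl⟩
    refine ⟨_, ⟨_, ⟨c • y, rfl⟩, rfl⟩, fun x (hx : π x = y) => ?_⟩
    exact (hequiv c x).trans (congrArg (c • ·) hx)

theorem isEquivariantFamily_image_preimage_coverPow {π : X → Y}
    (hequiv : ∀ (s : Γ) (x : X), π (s • x) = s • π x) (𝒱 : Set (Set Y)) :
    IsEquivariantFamily fun F : Finset Γ => Set.preimage π '' coverPow 𝒱 F where
  refines_of_subset h := (coverPow_refines_of_subset 𝒱 h).image_preimage π
  mul_singleton_refines F c := by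
    have hcomm : (c • · : Y → Y) ∘ π = π ∘ (c • · : X → X) := funext fun x => (hequiv c x).symm
    simp only [coverPow_mul_singleton, Set.image_image, ← Set.preimage_comp, hcomm]
    exact .refl _

section Subadditive

variable [TopologicalSpace X] [ContinuousConstSMul Γ X] {𝒜 : Finset Γ → Set (Set X)}
  {𝒰 : Set (Set X)}

theorem IsEquivariantFamily.relD_mul_singleton_le (h𝒜 : IsEquivariantFamily 𝒜)
    (h𝒰 : IsFinOpenCover 𝒰) (F : Finset Γ) (c : Γ) :
    relD (𝒜 (F * {c})) (coverPow 𝒰 (F * {c})) ≤ relD (𝒜 F) (coverPow 𝒰 F) := by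
  rw [coverPow_mul_singleton]
  exact (relD_mono (h𝒜.mul_singleton_refines F c)
    ((h𝒰.coverPow F).preimage (continuous_const_smul c)) (.refl _)).trans
    (relD_image_preimage_le (continuous_const_smul c) (𝒜 F) (h𝒰.coverPow F))

theorem IsEquivariantFamily.relD_union_le [NormalSpace X] (h𝒜 : IsEquivariantFamily 𝒜)
    (h𝒰 : IsFinOpenCover 𝒰) (F F' : Finset Γ) :
    relD (𝒜 (F ∪ F')) (coverPow 𝒰 (F ∪ F')) ≤
      relD (𝒜 F) (coverPow 𝒰 F) + relD (𝒜 F') (coverPow 𝒰 F') := by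
  have hF := h𝒰.coverPow F
  have hF' := h𝒰.coverPow F'
  calc relD (𝒜 (F ∪ F')) (coverPow 𝒰 (F ∪ F'))
      ≤ relD (𝒜 (F ∪ F')) (join (coverPow 𝒰 F) (coverPow 𝒰 F')) :=
        relD_mono (.refl _) (hF.join hF') (join_coverPow_refines 𝒰 F F')
    _ ≤ relD (𝒜 (F ∪ F')) (coverPow 𝒰 F) +
          relD (join (𝒜 (F ∪ F')) (coverPow 𝒰 F)) (coverPow 𝒰 F') :=
        relD_join_le_add _ hF hF'
    _ ≤ relD (𝒜 F) (coverPow 𝒰 F) + relD (𝒜 F') (coverPow 𝒰 F') := by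
        gcongr
        · exact relD_mono (h𝒜.refines_of_subset Finset.subset_union_left) hF (.refl _)
        · exact relD_mono ((join_refines_left _ _).trans
            (h𝒜.refines_of_subset Finset.subset_union_right)) hF' (.refl _)

theorem IsEquivariantFamily.isInvariantSubadditive [NormalSpace X] (h𝒜 : IsEquivariantFamily 𝒜)
    (h𝒰 : IsFinOpenCover 𝒰) :
    IsInvariantSubadditive fun F => (relD (𝒜 F) (coverPow 𝒰 F) : ℝ) where
  empty := by
    have hpow : Refines {Set.univ} (coverPow 𝒰 (∅ : Finset Γ)) :=
      .of_subset (by simp [coverPow])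
    have := (relD_mono (.refl (𝒜 ∅)) isFinOpenCover_univ hpow).trans
      (relD_le_ord _ isFinOpenCover_univ)
    rw [ord_singleton] at this
    exact_mod_cast Nat.le_zero.1 this
  union_le F F' := by exact_mod_cast h𝒜.relD_union_le h𝒰 F F'
  mul_singleton F c := by
    have hle := h𝒜.relD_mul_singleton_le h𝒰 (F * {c}) c⁻¹
    rw [mul_assoc, Finset.singleton_mul_singleton, mul_inv_cancel, Finset.singleton_one,
      mul_one] at hle
    exact_mod_cast (h𝒜.relD_mul_singleton_le h𝒰 F c).antisymm hle

end Subadditive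

end CoverPow

section Limits

open scoped NNReal

theorem natCast_div_le_iff {d n : ℕ} (hn : 0 < n) {t : ℝ≥0} :
    (d : ℝ≥0∞) / n ≤ t ↔ (d : ℝ) ≤ t * n := by
  rw [ENNReal.div_le_iff (by exact_mod_cast hn.ne') (ENNReal.natCast_ne_top n)]
  norm_cast

variable {Γ X Y : Type*} [Group Γ] [TopologicalSpace X] [MulAction Γ X]
  {π : X → Y} {𝒰 : Set (Set X)}

theorem condDAverage_le_iff {F : Finset Γ} (hF : F.Nonempty) {t : ℝ≥0} :
    condDAverage π 𝒰 F ≤ t ↔ (condD π (coverPow 𝒰 F) : ℝ) ≤ t * F.card :=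
  natCast_div_le_iff hF.card_pos

variable [ContinuousConstSMul Γ X] [NormalSpace X] [MulAction Γ Y]

theorem limsup_condDAverage_le_liminf (hΓ : IsAmenable Γ)
    (hequiv : ∀ (s : Γ) (x : X), π (s • x) = s • π x) (h𝒰 : IsFinOpenCover 𝒰) :
    limsup (condDAverage (Γ := Γ) π 𝒰) (invariantFilter Γ) ≤
      liminf (condDAverage (Γ := Γ) π 𝒰) (invariantFilter Γ) := by
  classical
  have := hΓ.neBot
  by_contra! hlt
  obtain ⟨a', hla', ha'u⟩ := ENNReal.lt_iff_exists_nnreal_btwn.1 hlt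
  obtain ⟨a, hla, haa'⟩ := ENNReal.lt_iff_exists_nnreal_btwn.1 hla'
  have hfreq : ∃ᶠ F in invariantFilter Γ, condDAverage π 𝒰 F < a ∧ F.Nonempty :=
    (frequently_lt_of_liminf_lt (by isBoundedDefault) hla).and_eventually (eventually_nonempty Γ)
  obtain ⟨𝒯, h𝒯, hev⟩ := exists_tiles_forall_le_mul_card hfreq a.coe_nonneg
    (by exact_mod_cast haa' : (a : ℝ) < a')
    (Nat.cast_nonneg (relD (fibers π) (coverPow 𝒰 ({1} : Finset Γ))))
  refine ha'u.not_ge (limsup_le_of_le (by isBoundedDefault) ?_)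
  filter_upwards [hev, eventually_nonempty Γ] with F hF hne
  refine (condDAverage_le_iff hne).2 (hF _
    ((isEquivariantFamily_fibers hequiv).isInvariantSubadditive h𝒰) le_rfl fun T hT => ?_)
  exact (condDAverage_le_iff (h𝒯 T hT).2).1 (h𝒯 T hT).1.le

theorem limitsExist_of_equivariant (hΓ : IsAmenable Γ)
    (hequiv : ∀ (s : Γ) (x : X), π (s • x) = s • π x) : LimitsExist Γ π := by
  classical
  have := hΓ.neBot
  intro 𝒰 h𝒰
  refine ⟨?_, tendsto_of_le_liminf_of_limsup_le
    (limsup_condDAverage_le_liminf hΓ hequiv h𝒰) le_rfl⟩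
  have hφ := (isEquivariantFamily_fibers hequiv).isInvariantSubadditive h𝒰
  have hbound : ∀ᶠ F in invariantFilter Γ, condDAverage π 𝒰 F ≤
      (condD π (coverPow 𝒰 ({1} : Finset Γ)) : ℝ≥0) :=
    (eventually_nonempty Γ).mono fun F hF => (condDAverage_le_iff hF).2 (hφ.le_mul_card F)
  exact ne_top_of_le_ne_top ENNReal.coe_ne_top (limsup_le_of_le (by isBoundedDefault) hbound)

end Limits

section Tower

open scoped NNReal

variable {Γ X Y Z : Type*} [Group Γ]
  [TopologicalSpace X] [CompactSpace X] [NormalSpace X] [MulAction Γ X] [ContinuousConstSMul Γ X]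
  [TopologicalSpace Y] [CompactSpace Y] [T2Space Y] [MulAction Γ Y] [ContinuousConstSMul Γ Y]
  {π : X → Y} {𝒰 : Set (Set X)}

theorem exists_cover_forall_relD_le_condD (hπ : Continuous π) (h𝒰 : IsFinOpenCover 𝒰)
    {𝒯 : Finset (Finset Γ)} (h𝒯 : ∀ T ∈ 𝒯, T.Nonempty) :
    ∃ 𝒱 : Set (Set Y), IsFinOpenCover 𝒱 ∧ ∀ T ∈ 𝒯,
      relD (Set.preimage π '' coverPow 𝒱 T) (coverPow 𝒰 T) ≤ condD π (coverPow 𝒰 T) := by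
  choose 𝒱 h𝒱 hle using fun T : Finset Γ => exists_relD_image_preimage_le_condD hπ (h𝒰.coverPow T)
  obtain ⟨𝒱₀, h𝒱₀, href⟩ := exists_coverPow_refines h𝒯 fun T _ => h𝒱 T
  refine ⟨𝒱₀, h𝒱₀, fun T hT => le_trans ?_ (hle T)⟩
  exact relD_mono ((href T hT).image_preimage π) (h𝒰.coverPow T) (.refl _)

/-- The tiles come first: they are chosen for `π` alone, and only then a cover `𝒱` of `Y` that is
fine enough for all of them. -/
theorem exists_coverMdim_comp_le (hΓ : IsAmenable Γ) (hπ : Continuous π)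
    (hequiv : ∀ (s : Γ) (x : X), π (s • x) = s • π x) (ρ : Y → Z) (h𝒰 : IsFinOpenCover 𝒰)
    {r : ℝ≥0} (hr : coverMdim Γ π 𝒰 < r) :
    ∃ 𝒱 : Set (Set Y), IsFinOpenCover 𝒱 ∧ coverMdim Γ (ρ ∘ π) 𝒰 ≤ coverMdim Γ ρ 𝒱 + r := by
  classical
  have := hΓ.neBot
  obtain ⟨a, hua, har⟩ := ENNReal.lt_iff_exists_nnreal_btwn.1 hr
  have hfreq : ∃ᶠ F in invariantFilter Γ, condDAverage π 𝒰 F < a ∧ F.Nonempty :=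
    ((eventually_lt_of_limsup_lt hua (by isBoundedDefault)).and (eventually_nonempty Γ)).frequently
  obtain ⟨𝒯, h𝒯, hev⟩ := exists_tiles_forall_le_mul_card hfreq a.coe_nonneg
    (by exact_mod_cast har : (a : ℝ) < r) (Nat.cast_nonneg (ord (coverPow 𝒰 ({1} : Finset Γ))))
  obtain ⟨𝒱, h𝒱, hle⟩ := exists_cover_forall_relD_le_condD hπ h𝒰 fun T hT => (h𝒯 T hT).2
  have hφ := (isEquivariantFamily_image_preimage_coverPow hequiv 𝒱).isInvariantSubadditive h𝒰
  have hbound : ∀ᶠ F in invariantFilter Γ,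
      condDAverage (ρ ∘ π) 𝒰 F ≤ condDAverage ρ 𝒱 F + r := by
    filter_upwards [hev, eventually_nonempty Γ] with F hF hne
    have hrelD : (relD (Set.preimage π '' coverPow 𝒱 F) (coverPow 𝒰 F) : ℝ) ≤ r * F.card := by
      refine hF _ hφ (by exact_mod_cast relD_le_ord _ (h𝒰.coverPow _)) fun T hT => ?_
      exact (Nat.cast_le.2 (hle T hT)).trans
        ((condDAverage_le_iff (h𝒯 T hT).2).1 (h𝒯 T hT).1.le)
    have hcomp : (condD (ρ ∘ π) (coverPow 𝒰 F) : ℝ≥0∞) ≤ condD ρ (coverPow 𝒱 F) +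
        relD (Set.preimage π '' coverPow 𝒱 F) (coverPow 𝒰 F) := by
      exact_mod_cast condD_comp_le hπ ρ (h𝒰.coverPow F) (h𝒱.coverPow F)
    refine (ENNReal.div_le_div_right hcomp _).trans ?_
    rw [ENNReal.add_div]
    exact add_le_add_right ((natCast_div_le_iff hne.card_pos).2 hrelD) _
  refine ⟨𝒱, h𝒱, (limsup_le_limsup hbound).trans_eq ?_⟩
  exact limsup_add_const _ _ _ (by isBoundedDefault) (by isBoundedDefault)

theorem condMdim_comp_le (hΓ : IsAmenable Γ) (hπ : Continuous π)
    (hequiv : ∀ (s : Γ) (x : X), π (s • x) = s • π x) (ρ : Y → Z) :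
    condMdim Γ (ρ ∘ π) ≤ condMdim Γ ρ + condMdim Γ π := by
  refine iSup₂_le fun 𝒰 h𝒰 => ?_
  suffices h : coverMdim Γ (ρ ∘ π) 𝒰 ≤ condMdim Γ ρ + coverMdim Γ π 𝒰 by
    exact h.trans (add_le_add_right (le_iSup₂ (f := fun 𝒰 _ => coverMdim Γ π 𝒰) 𝒰 h𝒰) _)
  refine ENNReal.le_of_forall_pos_le_add fun ε hε hfin => ?_
  lift coverMdim Γ π 𝒰 to ℝ≥0 using (limitsExist_of_equivariant hΓ hequiv 𝒰 h𝒰).1 with c hc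
  obtain ⟨𝒱, h𝒱, hle⟩ := exists_coverMdim_comp_le hΓ hπ hequiv ρ h𝒰 (r := c + ε)
    (by rw [← hc]; exact_mod_cast lt_add_of_pos_right c hε)
  calc coverMdim Γ (ρ ∘ π) 𝒰 ≤ coverMdim Γ ρ 𝒱 + ↑(c + ε) := hle
    _ ≤ condMdim Γ ρ + (c + ε) := by
        push_cast
        gcongr
        exact le_iSup₂ (f := fun 𝒱 _ => coverMdim Γ ρ 𝒱) 𝒱 h𝒱
    _ = condMdim Γ ρ + c + ε := (add_assoc _ _ _).symm

end Tower

end CondMdim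

theorem theorem1p2_general {Γ : Type*} [Group Γ] (hΓ : CondMdim.IsAmenable Γ) {X Y Z : Type*}
    [TopologicalSpace X] [CompactSpace X] [NormalSpace X] [MulAction Γ X]
    [ContinuousConstSMul Γ X] [TopologicalSpace Y] [CompactSpace Y] [T2Space Y] [MulAction Γ Y]
    [ContinuousConstSMul Γ Y] [MulAction Γ Z] {π : X → Y} (hπ : Continuous π)
    (hequiv : ∀ (s : Γ) (x : X), π (s • x) = s • π x) {ρ : Y → Z}
    (hρ : ∀ (s : Γ) (y : Y), ρ (s • y) = s • ρ y) :
    (CondMdim.LimitsExist Γ (ρ ∘ π) ∧ CondMdim.LimitsExist Γ ρ ∧ CondMdim.LimitsExist Γ π) ∧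
      CondMdim.condMdim Γ (ρ ∘ π) ≤ CondMdim.condMdim Γ ρ + CondMdim.condMdim Γ π := by
  have hρπ (s : Γ) (x : X) : (ρ ∘ π) (s • x) = s • (ρ ∘ π) x := by
    simp only [Function.comp_apply, hequiv, hρ]
  exact ⟨⟨CondMdim.limitsExist_of_equivariant hΓ hρπ, CondMdim.limitsExist_of_equivariant hΓ hρ,
    CondMdim.limitsExist_of_equivariant hΓ hequiv⟩, CondMdim.condMdim_comp_le hΓ hπ hequiv ρ⟩

theorem theorem1p2 {Γ : Type*} [Group Γ] [Countable Γ] (hΓ : CondMdim.IsAmenable Γ)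
    {X Y : Type*}
    [TopologicalSpace X] [CompactSpace X] [TopologicalSpace.MetrizableSpace X]
    [MulAction Γ X] [ContinuousConstSMul Γ X]
    [TopologicalSpace Y] [CompactSpace Y] [TopologicalSpace.MetrizableSpace Y]
    [MulAction Γ Y] [ContinuousConstSMul Γ Y]
    (π : X → Y) (hπ : Continuous π) (hsurj : Function.Surjective π)
    (hequiv : ∀ (s : Γ) (x : X), π (s • x) = s • π x) :
    -- the limits that enter the three mean dimensions exist
    (CondMdim.LimitsExist Γ (CondMdim.toPoint X) ∧ CondMdim.LimitsExist Γ (CondMdim.toPoint Y) ∧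
      CondMdim.LimitsExist Γ π) ∧
    CondMdim.mdim Γ X ≤ CondMdim.mdim Γ Y + CondMdim.condMdim Γ π := by
  exact theorem1p2_general hΓ hπ hequiv (ρ := CondMdim.toPoint Y) fun _ _ => rfl
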